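/- All matroids are finite. For a matroid $M$ with ground set $E$ and rank function $r$, let $\lambda_M(X)=r(X)+r(E\setminus X)-r(M)$ for $X\subseteq E$. For an integer $k\ge 1$, an exact $k$-separation of $M$ is a partition $(A,B)$ of $E$ with $|A|\ge k$, $|B|\ge k$ and $\lambda_M(A)=k-1$. A matroid is simple (cosimple) if it has no circuit (cocircuit) with at most two elements; a triangle (triad) is a three-element circuit (cocircuit). A single-element extension of $N$ by $e$ is a matroid $M$ with $e\in E(M)$ and $M\setminus e=N$; a single-element coextension of $N$ by $f$ is a matroid $M$ with $f\in E(M)$ and $M/f=N$. Theorem 1.1. Let $\mathcal M$ be a class of matroids closed under minors and isomorphism. Let $k\ge 1$ and let $N\in\mathcal M$ be a simple and cosimple matroid with an exact $k$-separation $(A,B)$ such that $A$ is a union of circuits of $N$ and a union of cocircuits of $N$. Suppose that the following hold for every $M\in\mathcal M$. (i) If $M$ is simple and is a single-element extension of $N$ by $e$, then $\lambda_M(A)=k-1$ or $\lambda_M(A\cup e)=k-1$. (ii) If $M$ is cosimple and is a single-element coextension of $N$ by $f$, then $\lambda_M(A)=k-1$ or $\lambda_M(A\cup f)=k-1$. (iii)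 If $M$ is a cosimple single-element coextension by $f$ of a simple single-element extension of $N$ by $e$, or $M$ is a simple single-element extension by $e$ of a cosimple single-element coextension of $N$ by $f$ (so that $M\setminus e/f=N$), then at least one of the following four cases occurs: (a) $\lambda_{M/f}(A)=k-1$ and $\lambda_{M\setminus e}(A)=k-1$; (b) $\lambda_{M/f}(A)=k-1$ and $\lambda_{M\setminus e}(A\cup f)=k-1$, and moreover either $\lambda_M(A\cup f)=k-1$ or $\{e,f,g\}$ is a triangle or a triad of $M$ for some $g\in A$; (c) $\lambda_{M/f}(A\cup e)=k-1$ and $\lambda_{M\setminus e}(A)=k-1$, and moreover either $\lambda_M(A\cup e)=k-1$ or $\{e,f,g\}$ is a triangle or a triad of $M$ for some $g\in A$; (d) $\lambda_{M/f}(A\cup e)=k-1$ and $\lambda_{M\setminus e}(A\cup f)=k-1$, and moreover $\{e,f,g\}$ is a triangle or a triad of $M$ for some $g\in A$. Then $N$ is a $k$-decomposer, having $(A,B)$ as an inducer, for every matroid in $\mathcal M$ with $N$ as a minor; that is, every $M\in\mathcal M$ that has $N$ as a minor has an exact $k$-separation $(X,Y)$ with $A\subseteq X$ and $B\subseteq Y$.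 -/

import Mathlib

namespace Decomposer

variable {α : Type*}

/-- The rank of `X` in a matroid, as a natural number (used only for finite matroids). -/
noncomputable def rk (M : Matroid α) (X : Set α) : ℕ := (M.eRk X).toNat

/-- The connectivity function `λ_M(X) = r(X) + r(E - X) - r(M)`. -/
noncomputable def conn (M : Matroid α) (X : Set α) : ℤ :=
  (rk M X : ℤ) + (rk M (M.E \ X) : ℤ) - (rk M M.E : ℤ)

/-- `(A, B)` is an exact `k`-separation of `M`: a partition of the ground set into two parts of
size at least `k` with `λ_M(A) = k - 1`. -/
structure IsExactSeparation (M : Matroid α) (k : ℕ) (A B : Set α) : Prop where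
  union_eq : A ∪ B = M.E
  disjoint : Disjoint A B
  le_left : (k : ℕ∞) ≤ A.encard
  le_right : (k : ℕ∞) ≤ B.encard
  conn_eq : conn M A = (k : ℤ) - 1

/-- A matroid is simple if it has no circuit with at most two elements. -/
def IsSimple (M : Matroid α) : Prop := ∀ C, M.IsCircuit C → 3 ≤ C.encard

/-- A matroid is cosimple if it has no cocircuit with at most two elements. -/
def IsCosimple (M : Matroid α) : Prop := ∀ K, M.IsCocircuit K → 3 ≤ K.encard

/-- `M` is a simple matroid that is a single-element extension of `N` by `e`. -/
structure IsSimpleExtension (M N : Matroid α) (e : α) : Prop where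
  simple : IsSimple M
  mem : e ∈ M.E
  delete_eq : M.delete {e} = N

/-- `M` is a cosimple matroid that is a single-element coextension of `N` by `f`. -/
structure IsCosimpleCoextension (M N : Matroid α) (f : α) : Prop where
  cosimple : IsCosimple M
  mem : f ∈ M.E
  contract_eq : M.contract {f} = N

/-- A triangle is a three-element circuit. -/
def IsTriangle (M : Matroid α) (T : Set α) : Prop := M.IsCircuit T ∧ T.encard = 3

/-- A triad is a three-element cocircuit. -/
def IsTriad (M : Matroid α) (T : Set α) : Prop := M.IsCocircuit T ∧ T.encard = 3

/-- `A` is a union of circuits of `M`. -/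
def IsUnionOfCircuits (M : Matroid α) (A : Set α) : Prop :=
  ∃ S : Set (Set α), (∀ C ∈ S, M.IsCircuit C) ∧ A = ⋃₀ S

/-- `A` is a union of cocircuits of `M`. -/
def IsUnionOfCocircuits (M : Matroid α) (A : Set α) : Prop :=
  ∃ S : Set (Set α), (∀ K ∈ S, M.IsCocircuit K) ∧ A = ⋃₀ S

/-- `𝓜` is a class of (finite) matroids, with ground sets in `α`, closed under minors and
isomorphism. The matroids on subsets of `α` isomorphic to `M` are exactly the images of `M` under
maps that are injective on the ground set. -/
structure IsMinorClosedClass (𝓜 : Set (Matroid α)) : Prop where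
  finite : ∀ M ∈ 𝓜, M.Finite
  minor : ∀ M ∈ 𝓜, ∀ N : Matroid α, N.IsMinor M → N ∈ 𝓜
  iso : ∀ M ∈ 𝓜, ∀ (φ : α → α) (hφ : Set.InjOn φ M.E), M.map φ hφ ∈ 𝓜

/-- `N` is a `k`-decomposer for `M` having `(A, B)` as an inducer; here `N` is a minor of `M` and
`(A, B)` is an exact `k`-separation of `N`. -/
structure IsDecomposer (k : ℕ) (N M : Matroid α) (A B : Set α) : Prop where
  minor : N.IsMinor M
  inducer : IsExactSeparation N k A B
  induced : ∃ X Y : Set α, IsExactSeparation M k X Y ∧ A ⊆ X ∧ B ⊆ Y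

/-- `{e, f, g}` is a triangle or a triad of `M` for some `g` in `A`. -/
def HasTriangleOrTriad (M : Matroid α) (A : Set α) (e f : α) : Prop :=
  ∃ g ∈ A, IsTriangle M {e, f, g} ∨ IsTriad M {e, f, g}

end Decomposer

namespace Decomposer

open Set Matroid

/-! ### Rank and connectivity under duality, deletion and contraction. -/

section Rank

variable {α : Type*} {M N P : Matroid α} {A B C D X Y : Set α} {e f g : α}

/-! Put `c = k - 1`. Connectivity does not increase in minors, so it suffices to find `X` containing
`A`, avoiding `B`, with `conn M X ≤ c` (`Good`). Take a bad `M` with smallest ground set and write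
`N = M ／ C ＼ D`. If `D ⊆ cl(B ∪ C)` and, dually, `C ⊆ cl*(B ∪ D)`, then restoring `D` and `C` leaves
the connectivity of `A` unchanged, and `X = A` works.

Minimality gives three tools. An element whose deletion and contraction both keep `N` makes `M` good
by uncrossing (`good_of_delete_of_contract`); this excludes loops and coloops. An element added to
`N` in parallel with some `g ∈ A` also makes `M` good (`SmallerGood.good_of_parallel`): it can play
the part of `g`, and the two resulting separations uncross. Everything dualizes.

The core is `SmallerGood.good_of_conn_ne`. Suppose `e ∈ D` cannot join `B` in the extension `P` of
`N`. Then `P` is simple, and (i) puts `e` in the closure of `A` in `P`. A good set `X` of `M ＼ {e}`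
cannot span `e`, and a modularity argument finds one `f ∈ C \ X` without which `e` leaves that
closure. Uncontracting only this `f` gives a two-element enlargement `Q` of `N` to which (iii)
applies. The cases without a triangle or triad are impossible, and a triangle or triad `{e, f, g}`
with `g ∈ A` yields a parallel or series pair meeting `A`. -/

lemma cast_rk (M : Matroid α) [M.Finite] (X : Set α) : (rk M X : ℕ∞) = M.eRk X :=
  ENat.natCast_toNat (by simp)

lemma rk_mono (M : Matroid α) [M.Finite] (h : X ⊆ Y) : rk M X ≤ rk M Y := by
  have := M.eRk_mono h
  rw [← cast_rk, ← cast_rk] at this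
  exact_mod_cast this

lemma rk_submod (M : Matroid α) [M.Finite] (X Y : Set α) :
    rk M (X ∩ Y) + rk M (X ∪ Y) ≤ rk M X + rk M Y := by
  have := M.eRk_inter_add_eRk_union_le X Y
  simp only [← cast_rk] at this
  exact_mod_cast this

lemma rk_inter_ground (M : Matroid α) (X : Set α) : rk M (X ∩ M.E) = rk M X := by
  simp [rk]

lemma rk_congr_inter (h : X ∩ M.E = Y ∩ M.E) : rk M X = rk M Y := by
  rw [← rk_inter_ground, h, rk_inter_ground]

@[simp] lemma rk_empty (M : Matroid α) : rk M ∅ = 0 := by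
  simp [rk]

lemma rk_union_of_subset_closure (h : Y ⊆ M.closure X) : rk M (X ∪ Y) = rk M X := by
  rw [rk, rk, ← M.eRk_closure_eq (X ∪ Y), ← closure_union_closure_left_eq,
    union_eq_self_of_subset_right h, closure_closure, eRk_closure_eq]

lemma rk_insert_of_mem_closure (h : e ∈ M.closure X) : rk M (insert e X) = rk M X := by
  rw [← union_singleton, rk_union_of_subset_closure (by simpa using h)]

lemma rk_insert_of_notMem_closure [M.Finite] (he : e ∈ M.E) (h : e ∉ M.closure X) :
    rk M (insert e X) = rk M X + 1 := by
  have := M.eRk_insert_eq_add_one (X := X) ⟨he, h⟩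
  simp only [← cast_rk] at this
  exact_mod_cast this

lemma mem_closure_of_rk_insert [M.Finite] (he : e ∈ M.E) (h : rk M (insert e X) ≤ rk M X) :
    e ∈ M.closure X := by
  by_contra hcon
  have := rk_insert_of_notMem_closure he hcon
  omega

lemma rk_singleton_le (M : Matroid α) [M.Finite] (e : α) : rk M {e} ≤ 1 := by
  have := M.eRk_singleton_le e
  rw [← cast_rk] at this
  exact_mod_cast this

lemma rk_union_le (M : Matroid α) [M.Finite] (X Y : Set α) :
    rk M (X ∪ Y) ≤ rk M X + rk M Y := by
  have := rk_submod M X Y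
  omega

lemma rk_le_ncard (M : Matroid α) [M.Finite] (hX : X ⊆ M.E) : rk M X ≤ X.ncard := by
  have := M.eRk_le_encard X
  rw [← cast_rk, ← (M.set_finite X hX).cast_ncard_eq] at this
  exact_mod_cast this

lemma indep_iff_rk [M.Finite] (hX : X ⊆ M.E) : M.Indep X ↔ rk M X = X.ncard := by
  rw [indep_iff_eRk_eq_encard, ← cast_rk, ← (M.set_finite X hX).cast_ncard_eq]
  norm_cast

lemma rk_delete (M : Matroid α) (D X : Set α) : rk (M ＼ D) X = rk M (X \ D) := by
  rw [rk, rk, delete_eq_restrict, restrict_eRk_eq', ← eRk_inter_ground (X := X \ D)]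
  congr 2
  ext; simp; tauto

lemma rk_dual (M : Matroid α) [M.Finite] (hX : X ⊆ M.E) :
    rk M✶ X + rk M M.E = X.ncard + rk M (M.E \ X) := by
  have := M.eRk_dual_add_eRank X
  rw [eRank_def, ← (M.set_finite X hX).cast_ncard_eq] at this
  simp only [← cast_rk] at this
  have h2 : rk M✶ X + rk M M.E = rk M (M.E \ X) + X.ncard := by exact_mod_cast this
  omega

lemma rk_contract (M : Matroid α) [M.Finite] (hC : C ⊆ M.E) (X : Set α) :
    rk (M ／ C) X + rk M C = rk M (X ∪ C) := by
  set Y := X ∩ (M.E \ C) with hY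
  have hYE : Y ⊆ M.E \ C := inter_subset_right
  have h1 : rk (M ／ C) X = rk (M ／ C) Y := rk_congr_inter (by simp [hY])
  have h2 : rk M (X ∪ C) = rk M (Y ∪ C) := rk_congr_inter (by
    ext x; simp [hY]; tauto)
  have e1 := rk_dual (M✶ ＼ C) (X := Y) (by simpa using hYE)
  rw [dual_delete, dual_dual, rk_delete, rk_delete, delete_ground, dual_ground] at e1
  have s1 : ((M.E \ C) \ C) = M.E \ C := by simp
  have s2 : (((M.E \ C) \ Y) \ C) = M.E \ (Y ∪ C) := by ext; simp; tauto
  rw [s1, s2] at e1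
  have e2 := rk_dual M (X := M.E \ C) sdiff_subset
  have e3 := rk_dual M (X := M.E \ (Y ∪ C)) sdiff_subset
  rw [sdiff_sdiff_cancel_left hC] at e2
  have hYC : Y ∪ C ⊆ M.E := union_subset (hYE.trans sdiff_subset) hC
  rw [sdiff_sdiff_cancel_left hYC] at e3
  have c1 : (M.E \ C).ncard = Y.ncard + (M.E \ (Y ∪ C)).ncard := by
    rw [← ncard_union_eq _ (M.set_finite _ (hYE.trans sdiff_subset)) (M.set_finite _ sdiff_subset)]
    · congr 1
      ext x
      have := @hYE x
      simp at this ⊢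
      tauto
    · exact disjoint_sdiff_right.mono_left subset_union_left
  rw [h1, h2]
  omega

lemma conn_eq (h : X ∪ Y = M.E) (hd : Disjoint X Y) :
    conn M X = (rk M X : ℤ) + rk M Y - rk M M.E := by
  rw [conn, ← h, union_sdiff_cancel_left hd.le_bot]

lemma conn_dual (M : Matroid α) [M.Finite] (hX : X ⊆ M.E) : conn M✶ X = conn M X := by
  have e1 := rk_dual M hX
  have e2 := rk_dual M (X := M.E \ X) sdiff_subset
  have e3 := rk_dual M subset_rfl
  rw [sdiff_sdiff_cancel_left hX] at e2
  have := ncard_sdiff_add_ncard_of_subset hX M.ground_finite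
  rw [sdiff_self] at e3
  simp only [rk_empty] at e3
  rw [conn, conn, dual_ground]
  omega

lemma conn_delete_le (M : Matroid α) [M.Finite] (hX : X ⊆ M.E) (D : Set α) :
    conn (M ＼ D) (X \ D) ≤ conn M X := by
  rw [conn, conn, delete_ground, rk_delete, rk_delete, rk_delete]
  have s1 : ((M.E \ D) \ (X \ D)) \ D = (M.E \ X) \ D := by ext; simp; tauto
  have s2 : (M.E \ D) \ D = M.E \ D := by simp
  have s3 : (X \ D) \ D = X \ D := by simp
  rw [s1, s2, s3]
  have h1 := rk_submod M X (M.E \ D)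
  have h2 := rk_submod M (M.E \ X) (X ∪ M.E \ D)
  have t1 : X ∩ (M.E \ D) = X \ D := by
    ext x; have := @hX x; simp; tauto
  have t2 : (M.E \ X) ∩ (X ∪ M.E \ D) = (M.E \ X) \ D := by ext; simp; tauto
  have t3 : (M.E \ X) ∪ (X ∪ M.E \ D) = M.E := by
    ext x; have := @hX x; simp; tauto
  rw [t1] at h1
  rw [t2, t3] at h2
  omega

lemma conn_contract_le (M : Matroid α) [M.Finite] (hX : X ⊆ M.E) (C : Set α) :
    conn (M ／ C) (X \ C) ≤ conn M X := by
  have := conn_delete_le M✶ hX C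
  rwa [← conn_dual _ (by simpa using sdiff_subset_sdiff_left hX), dual_delete, dual_dual,
    conn_dual _ hX] at this

lemma conn_le_of_isMinor [M.Finite] (h : P ≤m M) (hX : X ⊆ M.E) :
    conn P (X ∩ P.E) ≤ conn M X := by
  obtain ⟨C, D, rfl⟩ := h
  have h1 := conn_contract_le M hX C
  have h2 := conn_delete_le (M ／ C) (X := X \ C) (by simpa using sdiff_subset_sdiff_left hX) D
  have : X ∩ (M ／ C ＼ D).E = (X \ C) \ D := by
    ext x; have := @hX x; simp; tauto
  rw [this]
  exact h2.trans h1

/-- The rest of the far side spans `D`, so deleting `D` lowers neither the rank of that side nor the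
rank of the matroid. -/
lemma conn_delete_eq [M.Finite] (hXD : Disjoint X D)
    (hD : D ⊆ M.closure ((M.E \ X) \ D)) : conn (M ＼ D) X = conn M X := by
  have hDE : D ⊆ M.E := hD.trans (M.closure_subset_ground _)
  rw [conn, conn, delete_ground, rk_delete, rk_delete, rk_delete, hXD.sdiff_eq_left]
  have s1 : ((M.E \ D) \ X) \ D = (M.E \ X) \ D := by ext; simp; tauto
  have s2 : (M.E \ D) \ D = M.E \ D := by simp
  rw [s1, s2]
  have h1 := rk_union_of_subset_closure hD
  have h2 := rk_union_of_subset_closure (X := M.E \ D) (hD.trans (M.closure_subset_closure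
    (sdiff_subset_sdiff_left sdiff_subset)))
  have t1 : (M.E \ X) \ D ∪ D = M.E \ X := by
    rw [sdiff_union_self, union_eq_self_of_subset_right]
    exact subset_sdiff.2 ⟨hDE, hXD.symm⟩
  rw [sdiff_union_of_subset hDE] at h2
  rw [t1] at h1
  rw [h1, h2]

lemma conn_contract_eq [M.Finite] (hX : X ⊆ M.E) (hXC : Disjoint X C)
    (hC : C ⊆ M✶.closure ((M.E \ X) \ C)) : conn (M ／ C) X = conn M X := by
  have h := conn_delete_eq (M := M✶) hXC hC
  rwa [conn_dual _ hX, ← conn_dual _ (by simpa using subset_sdiff.2 ⟨hX, hXC⟩), dual_delete,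
    dual_dual] at h

end Rank

/-! ### Minors, and relabelling by a transposition. -/

section Minor

variable {α : Type*} {M N P : Matroid α} {A B C D X Y K : Set α} {e f g x : α}

lemma isMinor_dual (h : N ≤m M) : N✶ ≤m M✶ := by
  obtain ⟨C, D, rfl⟩ := h
  rw [dual_contract_delete, delete_contract_comm']
  exact ⟨_, _, rfl⟩

lemma isMinor_dual_iff : N✶ ≤m M✶ ↔ N ≤m M :=
  ⟨fun h ↦ by simpa using isMinor_dual h, isMinor_dual⟩

lemma delete_isMinor (M : Matroid α) (D : Set α) : M ＼ D ≤m M := ⟨∅, D, by simp⟩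

lemma contract_isMinor (M : Matroid α) (C : Set α) : M ／ C ≤m M := ⟨C, ∅, by simp⟩

lemma delete_isMinor_delete (h : P ≤m M) (he : e ∈ P.E) : P ＼ {e} ≤m M ＼ {e} := by
  obtain ⟨C, D, rfl⟩ := h
  refine ⟨C, D, ?_⟩
  have heC : Disjoint C {e} := by
    rw [disjoint_singleton_right]
    exact he.1.2
  rw [delete_comm, contract_delete_comm _ heC]

lemma contract_isMinor_contract (h : P ≤m M) (he : e ∈ P.E) : P ／ {e} ≤m M ／ {e} := by
  rw [← isMinor_dual_iff, dual_contract, dual_contract]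
  exact delete_isMinor_delete (isMinor_dual h) he

lemma mem_closure_of_mem_closure_minor (h : x ∈ (M ／ C ＼ D).closure X) :
    x ∈ M.closure (X ∪ C) := by
  rw [delete_closure_eq, contract_closure_eq] at h
  exact M.closure_subset_closure (union_subset_union_left _ sdiff_subset) h.1.1

lemma image_perm_eq_self {σ : Equiv.Perm α} (h : ∀ x ∈ X, σ x = x) : σ '' X = X := by
  simpa using image_congr h

lemma delete_mapEquiv (M : Matroid α) (D : Set α) (σ : Equiv.Perm α) :
    (M ＼ D).mapEquiv σ = M.mapEquiv σ ＼ (σ '' D) := by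
  refine ext_indep (by simp [image_sdiff σ.injective]) fun I _ ↦ ?_
  rw [mapEquiv_indep_iff, delete_indep_iff, delete_indep_iff, mapEquiv_indep_iff,
    ← disjoint_image_iff σ.injective]
  simp

lemma dual_mapEquiv (M : Matroid α) (σ : Equiv.Perm α) : (M.mapEquiv σ)✶ = M✶.mapEquiv σ :=
  map_dual (hf := σ.injective.injOn)

lemma contract_mapEquiv (M : Matroid α) (C : Set α) (σ : Equiv.Perm α) :
    (M ／ C).mapEquiv σ = M.mapEquiv σ ／ (σ '' C) := by
  rw [← dual_inj, dual_mapEquiv, dual_contract, delete_mapEquiv, dual_contract, dual_mapEquiv]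

lemma conn_mapEquiv (M : Matroid α) (σ : Equiv.Perm α) (hX : X ⊆ M.E) :
    conn (M.mapEquiv σ) (σ '' X) = conn M X := by
  have h : ∀ Y ⊆ M.E, rk (M.mapEquiv σ) (σ '' Y) = rk M Y := fun Y hY ↦ by
    rw [rk, rk, mapEquiv_eq_map, eRk_map _ _ hY]
  rw [conn, conn, mapEquiv_ground_eq, ← image_sdiff σ.injective, h _ hX, h _ sdiff_subset,
    h _ subset_rfl]

/-- Every flat contains both or neither of `e` and `g`, so one may replace the other in an
independent set. -/
lemma delete_mapEquiv_swap_eq [DecidableEq α] (heg : e ∈ P.closure {g}) (hge : g ∈ P.closure {e})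
    (hne : e ≠ g) : (P ＼ {g}).mapEquiv (Equiv.swap e g) = P ＼ {e} := by
  have heE := mem_ground_of_mem_closure heg
  have hgE := mem_ground_of_mem_closure hge
  have hE : ((P ＼ {g}).mapEquiv (Equiv.swap e g)).E = (P ＼ {e}).E := by
    rw [mapEquiv_ground_eq, Equiv.image_eq_preimage_symm, Equiv.symm_swap]
    ext x
    simp only [delete_ground, mem_preimage, mem_sdiff, mem_singleton_iff]
    obtain rfl | hxe := eq_or_ne x e
    · simp
    obtain rfl | hxg := eq_or_ne x g
    · simp [heE, hgE, hne, hne.symm]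
    rw [Equiv.swap_apply_of_ne_of_ne hxe hxg]
    tauto
  refine ext_indep hE fun I hI ↦ ?_
  rw [hE, delete_ground, subset_sdiff, disjoint_singleton_right] at hI
  rw [mapEquiv_indep_iff, Equiv.symm_swap, deleteElem_indep_iff, deleteElem_indep_iff,
    and_iff_left hI.2, and_iff_left]
  · by_cases hg : g ∈ I
    · obtain ⟨J, hgJ, rfl⟩ : ∃ J, g ∉ J ∧ insert g J = I := ⟨I \ {g}, by simp, by simp [hg]⟩
      have heJ : e ∉ J := fun h ↦ hI.2 (by simp [h])
      rw [image_insert_eq, Equiv.swap_apply_right, image_perm_eq_self (X := J), insert_indep_iff,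
        insert_indep_iff]
      · have : e ∈ P.closure J ↔ g ∈ P.closure J :=
          ⟨fun h ↦ P.closure_subset_closure_of_subset_closure (by simpa using h) hge,
            fun h ↦ P.closure_subset_closure_of_subset_closure (by simpa using h) heg⟩
        simp [hgJ, heJ, heE, hgE, this]
      · intro x hx
        exact Equiv.swap_apply_of_ne_of_ne (by rintro rfl; exact heJ hx)
          (by rintro rfl; exact hgJ hx)
    · rw [image_perm_eq_self]
      intro x hx
      exact Equiv.swap_apply_of_ne_of_ne (by rintro rfl; exact hI.2 hx)
        (by rintro rfl; exact hg hx)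
  · rintro ⟨x, hx, hxg⟩
    rw [Equiv.swap_apply_eq_iff, Equiv.swap_apply_right] at hxg
    exact hI.2 (hxg ▸ hx)

/-- The transposition fixes `C` and `D`, so the exchange in the minor lifts to `M`, even though `e`
and `g` need not be parallel there. -/
lemma isMinor_mapEquiv_swap [DecidableEq α]
    (heg : e ∈ (M ／ C ＼ D).closure {g}) (hge : g ∈ (M ／ C ＼ D).closure {e}) (hne : e ≠ g) :
    (M ／ C ＼ D) ＼ {e} ≤m (M ＼ {g}).mapEquiv (Equiv.swap e g) := by
  have heE := mem_ground_of_mem_closure heg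
  have hgE := mem_ground_of_mem_closure hge
  have hfix : ∀ Z : Set α, e ∉ Z → g ∉ Z → Equiv.swap e g '' Z = Z := fun Z h1 h2 ↦
    image_perm_eq_self fun x hx ↦ Equiv.swap_apply_of_ne_of_ne (by rintro rfl; exact h1 hx)
      (by rintro rfl; exact h2 hx)
  refine ⟨C, D, ?_⟩
  rw [← delete_mapEquiv_swap_eq heg hge hne, delete_comm, contract_delete_comm, delete_mapEquiv,
    contract_mapEquiv, hfix C heE.1.2 hgE.1.2, hfix D heE.2 hgE.2]
  simpa using hgE.1.2

end Minor

/-! ### Self-dual hypotheses, uncrossing, and reductions in a minimal counterexample. -/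

section Hyp

variable {α : Type*} {𝓜 : Set (Matroid α)} {c : ℤ} {M N P : Matroid α} {A B C D X Y K : Set α}
  {e f g x : α}

/-- `M` has a separation of connectivity at most `c` whose sides contain `A` and `B`. -/
def Good (A B : Set α) (c : ℤ) (M : Matroid α) : Prop :=
  ∃ X, A ⊆ X ∧ X ⊆ M.E ∧ Disjoint X B ∧ conn M X ≤ c

/-- The hypotheses of the decomposition theorem, in a form that is closed under duality. -/
structure Hyp (𝓜 : Set (Matroid α)) (c : ℤ) (N : Matroid α) (A B : Set α) : Prop where
  finite : ∀ M ∈ 𝓜, M.Finite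
  minor : ∀ M ∈ 𝓜, ∀ P : Matroid α, P ≤m M → P ∈ 𝓜
  iso : ∀ M ∈ 𝓜, ∀ σ : Equiv.Perm α, M.mapEquiv σ ∈ 𝓜
  simple : IsSimple N
  cosimple : IsSimple N✶
  union_eq : A ∪ B = N.E
  disjoint : Disjoint A B
  conn_eq : conn N A = c
  mem_closure : ∀ g ∈ A, g ∈ N.closure (A \ {g})
  mem_dual_closure : ∀ g ∈ A, g ∈ N✶.closure (A \ {g})
  extension : ∀ M ∈ 𝓜, ∀ e ∈ M.E, M ＼ {e} = N → IsSimple M →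
    conn M A = c ∨ conn M (A ∪ {e}) = c
  coextension : ∀ M ∈ 𝓜, ∀ f ∈ M.E, M ／ {f} = N → IsSimple M✶ →
    conn M A = c ∨ conn M (A ∪ {f}) = c
  pair : ∀ M ∈ 𝓜, ∀ e ∈ M.E, ∀ f ∈ M.E, e ≠ f → M ／ {f} ＼ {e} = N →
    IsSimple (M ／ {f}) → IsSimple M✶ →
    conn (M ／ {f}) A ≠ c → conn (M ＼ {e}) A = c → conn M (A ∪ {e}) ≠ c →
    ∃ g ∈ A, M.Dep {e, f, g} ∨ M✶.Dep {e, f, g}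
  copair : ∀ M ∈ 𝓜, ∀ e ∈ M.E, ∀ f ∈ M.E, e ≠ f → M ／ {f} ＼ {e} = N →
    IsSimple (M ＼ {e})✶ → IsSimple M →
    conn (M ＼ {e}) A ≠ c → conn (M ／ {f}) A = c → conn M (A ∪ {f}) ≠ c →
    ∃ g ∈ A, M.Dep {e, f, g} ∨ M✶.Dep {e, f, g}

lemma Hyp.left_subset (H : Hyp 𝓜 c N A B) : A ⊆ N.E := H.union_eq ▸ subset_union_left

lemma Hyp.right_subset (H : Hyp 𝓜 c N A B) : B ⊆ N.E := H.union_eq ▸ subset_union_right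

/-- Duality exchanges `extension` with `coextension`, and `pair` with `copair` with the roles of `e`
and `f` reversed. -/
lemma Hyp.dual (H : Hyp 𝓜 c N A B) (hN : N.Finite) : Hyp {M | M✶ ∈ 𝓜} c N✶ A B where
  finite M hM := by
    have := H.finite _ hM
    simpa using M✶.dual_finite
  minor M hM P hP := H.minor _ hM _ (isMinor_dual hP)
  iso M hM σ := by
    have := H.iso _ hM σ
    rwa [← dual_mapEquiv] at this
  simple := H.cosimple
  cosimple := by simpa using H.simple
  union_eq := H.union_eq
  disjoint := H.disjoint
  conn_eq := by rw [conn_dual _ H.left_subset, H.conn_eq]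
  mem_closure := H.mem_dual_closure
  mem_dual_closure := by simpa using H.mem_closure
  extension M hM e he hMN hs := by
    have hfin := H.finite _ hM
    have hE : M✶.E = insert e N.E := by
      rw [← N.dual_ground, ← hMN]; simp [he]
    have hA := H.left_subset
    rw [← M.dual_dual, conn_dual M✶, conn_dual M✶]
    · exact H.coextension _ hM e he (by rw [← dual_inj, ← hMN]; simp) (by simpa using hs)
    · rw [hE]; grind
    · rw [hE]; grind
  coextension M hM e he hMN hs := by
    have hfin := H.finite _ hM
    have hE : M✶.E = insert e N.E := by
      rw [← N.dual_ground, ← hMN]; simp [he]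
    have hA := H.left_subset
    rw [← M.dual_dual, conn_dual M✶, conn_dual M✶]
    · exact H.extension _ hM e he (by rw [← dual_inj, ← hMN]; simp) (by simpa using hs)
    · rw [hE]; grind
    · rw [hE]; grind
  pair M hM e he f hf hne hMN hs hs' h1 h2 h3 := by
    have hfin := H.finite _ hM
    have hE : M✶.E = insert e (insert f N.E) := by
      rw [← N.dual_ground, ← hMN]; ext x; simp; grind
    have hA := H.left_subset
    have heA : e ∉ A := fun h ↦ by
      have := hA h
      rw [← dual_ground, ← hMN] at this
      simp at this
    have hfA : f ∉ A := fun h ↦ by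
      have := hA h
      rw [← dual_ground, ← hMN] at this
      simp at this
    have := H.copair M✶ hM f hf e he hne.symm
      (by rw [← dual_inj, ← hMN, dual_contract_delete, dual_dual, contract_delete_comm]
          simpa using hne.symm)
      (by simpa using hs) hs'
      (by rwa [← conn_dual, dual_delete, dual_dual]
          rw [delete_ground, hE]; grind)
      (by rwa [← conn_dual, dual_contract, dual_dual]
          rw [contract_ground, hE]; grind)
      (by rwa [← conn_dual, dual_dual]
          rw [hE]; grind)
    simpa [insert_comm, or_comm] using this
  copair M hM e he f hf hne hMN hs hs' h1 h2 h3 := by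
    have hfin := H.finite _ hM
    have hE : M✶.E = insert e (insert f N.E) := by
      rw [← N.dual_ground, ← hMN]; ext x; simp; grind
    have hA := H.left_subset
    have heA : e ∉ A := fun h ↦ by
      have := hA h
      rw [← dual_ground, ← hMN] at this
      simp at this
    have hfA : f ∉ A := fun h ↦ by
      have := hA h
      rw [← dual_ground, ← hMN] at this
      simp at this
    have := H.pair M✶ hM f hf e he hne.symm
      (by rw [← dual_inj, ← hMN, dual_contract_delete, dual_dual, contract_delete_comm]
          simpa using hne.symm)
      (by simpa using hs) (by simpa using hs')
      (by rwa [← conn_dual, dual_contract, dual_dual]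
          rw [contract_ground, hE]; grind)
      (by rwa [← conn_dual, dual_delete, dual_dual]
          rw [delete_ground, hE]; grind)
      (by rwa [← conn_dual, dual_dual]
          rw [hE]; grind)
    simpa [insert_comm, or_comm] using this

lemma good_dual_iff [M.Finite] : Good A B c M✶ ↔ Good A B c M := by
  refine exists_congr fun X ↦ and_congr_right fun _ ↦ and_congr_right fun hX ↦ ?_
  rw [conn_dual M hX]

/-- Uncrossing: the connectivities in `M` of the intersection and of the union with `x` add up to at
most `2 * c + 1`, so by integrality one is at most `c`. The extra 1 bounds the rank of `{x}`. -/
lemma good_of_delete_of_contract [M.Finite] (hx : x ∈ M.E) (hxB : x ∉ B)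
    (h1 : Good A B c (M ＼ {x})) (h2 : Good A B c (M ／ {x})) : Good A B c M := by
  obtain ⟨X, hAX, hXE, hXB, hX⟩ := h1
  obtain ⟨Z, hAZ, hZE, hZB, hZ⟩ := h2
  rw [conn, rk_delete, rk_delete, rk_delete, delete_ground] at hX
  rw [conn, contract_ground] at hZ
  have hxE : {x} ⊆ M.E := by simpa using hx
  have c1 := rk_contract M hxE Z
  have c2 := rk_contract M hxE ((M.E \ {x}) \ Z)
  have c3 := rk_contract M hxE (M.E \ {x})
  rw [delete_ground] at hXE
  rw [contract_ground] at hZE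
  have m1 := rk_submod M X (Z ∪ {x})
  have m2 := rk_submod M ((M.E \ {x}) \ X) (((M.E \ {x}) \ Z) ∪ {x})
  have t1 : X \ {x} = X := by grind
  have t2 : ((M.E \ {x}) \ X) \ {x} = (M.E \ {x}) \ X := by grind
  have t3 : (M.E \ {x}) \ {x} = M.E \ {x} := by grind
  have t4 : M.E \ {x} ∪ {x} = M.E := by grind
  have t5 : (M.E \ {x}) \ X ∩ (((M.E \ {x}) \ Z) ∪ {x}) = M.E \ (X ∪ (Z ∪ {x})) := by grind
  have t6 : (M.E \ {x}) \ X ∪ (((M.E \ {x}) \ Z) ∪ {x}) = M.E \ (X ∩ (Z ∪ {x})) := by grind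
  rw [t1, t2, t3] at hX
  rw [t4] at c3
  rw [t5, t6] at m2
  have m3 := rk_mono M (sdiff_subset : M.E \ {x} ⊆ M.E)
  have m4 := rk_singleton_le M x
  by_cases h : conn M (X ∩ (Z ∪ {x})) ≤ c
  · exact ⟨_, by grind, by grind, hXB.mono_left inter_subset_left, h⟩
  refine ⟨X ∪ (Z ∪ {x}), by grind, by grind, ?_, ?_⟩
  · simp [hXB, hZB, hxB]
  rw [conn] at h ⊢
  omega

/-- All smaller members of `𝓜` with `N` as a minor are good. -/
def SmallerGood (𝓜 : Set (Matroid α)) (c : ℤ) (N : Matroid α) (A B : Set α) (M : Matroid α) :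
    Prop :=
  ∀ P ∈ 𝓜, N ≤m P → P.E.ncard < M.E.ncard → Good A B c P

lemma ncard_sdiff_singleton_ground_lt [M.Finite] (hx : x ∈ M.E) :
    (M.E \ {x}).ncard < M.E.ncard :=
  ncard_sdiff_singleton_lt_of_mem hx M.ground_finite

lemma SmallerGood.delete (h : SmallerGood 𝓜 c N A B M) (H : Hyp 𝓜 c N A B) (hM : M ∈ 𝓜)
    (hx : x ∈ M.E) (hN : N ≤m M ＼ {x}) : Good A B c (M ＼ {x}) := by
  have := H.finite _ hM
  exact h _ (H.minor _ hM _ (delete_isMinor _ _)) hN (ncard_sdiff_singleton_ground_lt hx)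

lemma SmallerGood.contract (h : SmallerGood 𝓜 c N A B M) (H : Hyp 𝓜 c N A B) (hM : M ∈ 𝓜)
    (hx : x ∈ M.E) (hN : N ≤m M ／ {x}) : Good A B c (M ／ {x}) := by
  have := H.finite _ hM
  exact h _ (H.minor _ hM _ (contract_isMinor _ _)) hN (ncard_sdiff_singleton_ground_lt hx)

lemma SmallerGood.dual [M.Finite] (h : SmallerGood 𝓜 c N A B M) (H : Hyp 𝓜 c N A B) :
    SmallerGood {M | M✶ ∈ 𝓜} c N✶ A B M✶ := by
  intro P hP hNP hlt
  have := H.finite _ hP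
  have hP' : Good A B c P✶ := h _ hP (by simpa using isMinor_dual hNP) hlt
  simpa using good_dual_iff.2 hP'

lemma SmallerGood.good_of_both (h : SmallerGood 𝓜 c N A B M) (H : Hyp 𝓜 c N A B) (hM : M ∈ 𝓜)
    (hx : x ∈ M.E) (h1 : N ≤m M ＼ {x}) (h2 : N ≤m M ／ {x}) : Good A B c M := by
  have := H.finite _ hM
  refine good_of_delete_of_contract hx (fun hxB ↦ ?_) (h.delete H hM hx h1) (h.contract H hM hx h2)
  simpa using h1.subset (H.right_subset hxB)

lemma SmallerGood.good_of_both_minor (h : SmallerGood 𝓜 c N A B M) (H : Hyp 𝓜 c N A B)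
    (hM : M ∈ 𝓜) (hP : P ≤m M) (hx : x ∈ P.E) (h1 : N ≤m P ＼ {x}) (h2 : N ≤m P ／ {x}) :
    Good A B c M :=
  h.good_of_both H hM (hP.subset hx) (h1.trans (delete_isMinor_delete hP hx))
    (h2.trans (contract_isMinor_contract hP hx))

/-- Deleting and contracting a loop agree, so `N` survives both operations. -/
lemma SmallerGood.good_of_isLoop (h : SmallerGood 𝓜 c N A B M) (H : Hyp 𝓜 c N A B)
    (hM : M ∈ 𝓜) (hP : P ≤m M) (hx : P.IsLoop x) (hN : N ≤m P ＼ {x} ∨ N ≤m P ／ {x}) :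
    Good A B c M := by
  have := contract_eq_delete_of_subset_loops (M := P) (X := {x}) (singleton_subset_iff.2 hx)
  rw [this, or_self] at hN
  exact h.good_of_both_minor H hM hP hx.mem_ground hN (this ▸ hN)

lemma SmallerGood.good_of_isColoop (h : SmallerGood 𝓜 c N A B M) (H : Hyp 𝓜 c N A B)
    (hM : M ∈ 𝓜) (hP : P ≤m M) (hx : P.IsColoop x) (hN : N ≤m P ＼ {x} ∨ N ≤m P ／ {x}) :
    Good A B c M := by
  have := contract_eq_delete_of_subset_coloops (M := P) (X := {x}) (singleton_subset_iff.2 hx)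
  rw [this, or_self] at hN
  exact h.good_of_both_minor H hM hP hx.mem_ground hN (this ▸ hN)

/-- Since `A` is a union of circuits, removing `g` keeps the rank of `A` and of `N`. This is the
lower bound used in uncrossing below. -/
lemma Hyp.conn_le_of_delete (H : Hyp 𝓜 c N A B) [N.Finite] (hg : g ∈ A) :
    c ≤ conn (N ＼ {g}) (A \ {g}) := by
  have hA := H.left_subset
  have hdisj := H.disjoint
  have hE := H.union_eq
  have hcl := H.mem_closure g hg
  have h1 := rk_insert_of_mem_closure hcl
  have h2 := rk_insert_of_mem_closure (N.closure_subset_closure (sdiff_subset_sdiff_left hA) hcl)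
  rw [insert_sdiff_self_of_mem hg] at h1
  rw [insert_sdiff_self_of_mem (hA hg)] at h2
  have h3 := Decomposer.conn_eq hE hdisj
  have hgB : g ∉ B := hdisj.notMem_of_mem_left hg
  rw [Decomposer.conn_eq (Y := B), delete_ground, rk_delete, rk_delete, rk_delete]
  · have t1 : (A \ {g}) \ {g} = A \ {g} := by simp
    have t2 : (N.E \ {g}) \ {g} = N.E \ {g} := by simp
    rw [t1, t2, sdiff_singleton_eq_self hgB]
    have := H.conn_eq
    omega
  · rw [delete_ground, ← hE]; grind
  · exact hdisj.mono_left sdiff_subset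

/-- Let `X` be good for `M ＼ {e}`, and let `Z` come from `M ＼ {g}` with `e` in the role of `g`.
Their intersection separates `M ＼ {e} ＼ {g}` with connectivity at least `c`, so submodularity leaves
at most `c` for `X ∪ Z` in `M`. -/
lemma SmallerGood.good_of_parallel (h : SmallerGood 𝓜 c N A B M) (H : Hyp 𝓜 c N A B) (hM : M ∈ 𝓜)
    (hP : P ≤m M) (hPN : P ＼ {e} = N) (hg : g ∈ A) (heg : e ∈ P.closure {g})
    (hge : g ∈ P.closure {e}) : Good A B c M := by
  classical
  have hfin := H.finite _ hM
  have hNM : N ≤m M := hPN ▸ (delete_isMinor _ _).trans hP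
  have hfinN := H.finite _ (H.minor _ hM _ hNM)
  have hgN := H.left_subset hg
  have hne : e ≠ g := by rintro rfl; simp [← hPN] at hgN
  have heP := mem_ground_of_mem_closure heg
  have heM := hP.subset heP
  have heN : e ∉ N.E := by simp [← hPN]
  have hNe : N ≤m M ＼ {e} := hPN ▸ delete_isMinor_delete hP heP
  obtain ⟨X, hAX, hXE, hXB, hX⟩ := h.delete H hM heM hNe
  obtain ⟨C, D, rfl⟩ := hP
  have hgM := hNM.subset hgN
  have hNM' : N ≤m (M ＼ {g}).mapEquiv (Equiv.swap e g) :=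
    hPN ▸ isMinor_mapEquiv_swap heg hge hne
  obtain ⟨Z', hAZ', hZ'E, hZ'B, hZ'⟩ := h ((M ＼ {g}).mapEquiv (Equiv.swap e g))
    (H.iso _ (H.minor _ hM _ (delete_isMinor _ _)) _) hNM' (by
      rw [mapEquiv_ground_eq, ncard_image_of_injective _ (Equiv.injective _)]
      exact ncard_sdiff_singleton_ground_lt hgM)
  obtain ⟨Z, hZE, hZeq⟩ := subset_image_iff.1 hZ'E
  replace hZeq : Equiv.swap e g '' Z = Z' := hZeq
  subst hZeq
  rw [conn_mapEquiv _ _ hZE] at hZ'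
  have hmem : ∀ x ∈ N.E, x ≠ g → (x ∈ Z ↔ x ∈ Equiv.swap e g '' Z) := by
    intro x hx hxg
    rw [Equiv.image_eq_preimage_symm, Equiv.symm_swap, mem_preimage,
      Equiv.swap_apply_of_ne_of_ne (by rintro rfl; exact heN hx) hxg]
  have hAZ : A \ {g} ⊆ Z := fun x hx ↦ (hmem x (H.left_subset hx.1) hx.2).2 (hAZ' hx.1)
  have heZ : e ∈ Z := by
    have := hAZ' hg
    rwa [Equiv.image_eq_preimage_symm, Equiv.symm_swap, mem_preimage,
      Equiv.swap_apply_right] at this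
  have hgB : g ∉ B := H.disjoint.notMem_of_mem_left hg
  have hZB : Disjoint Z B := by
    rw [disjoint_left] at hZ'B ⊢
    intro x hx hxB
    exact hZ'B ((hmem x (H.right_subset hxB) (by rintro rfl; exact hgB hxB)).1 hx) hxB
  rw [delete_ground] at hXE hZE
  -- Removing `e` and `g` must not lower the rank of `M`: `g` is spanned by `A \ {g}` and `C`, and
  -- `e` by `g` and `C`.
  have hCDE : (A \ {g}) ∪ (C ∩ M.E) ⊆ (M.E \ {e}) \ {g} := by
    have hAN := H.left_subset
    have hNE : N.E ⊆ M.E := hNM.subset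
    have := heP.1.2
    have : g ∉ C := (mem_ground_of_mem_closure hge).1.2
    grind
  have hgcl : g ∈ M.closure ((M.E \ {e}) \ {g}) := by
    have h1 := H.mem_closure g hg
    rw [← hPN, delete_delete] at h1
    have h2 := mem_closure_of_mem_closure_minor h1
    rw [← closure_inter_ground] at h2
    refine M.closure_subset_closure (subset_trans ?_ hCDE) h2
    grind
  have hecl : e ∈ M.closure (M.E \ {e}) := by
    have h1 := mem_closure_of_mem_closure_minor heg
    rw [← closure_inter_ground] at h1
    refine M.closure_subset_closure ?_ h1
    grind [heP.1.2]
  have r1 := rk_insert_of_mem_closure hgcl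
  have r2 := rk_insert_of_mem_closure hecl
  rw [insert_sdiff_self_of_mem heM] at r2
  rw [insert_sdiff_self_of_mem (show g ∈ M.E \ {e} from ⟨hgM, hne.symm⟩)] at r1
  have r3 := rk_mono M (show (M.E \ {e}) \ {g} ⊆ M.E \ {g} by grind)
  have r4 := rk_mono M (show M.E \ {g} ⊆ M.E by grind)
  have hlow := conn_le_of_isMinor (M := M ＼ {e} ＼ {g}) (X := X ∩ Z)
    (delete_isMinor_delete hNe hgN) (by rw [delete_ground, delete_ground]; grind)
  have hXZ : X ∩ Z ∩ (N ＼ {g}).E = A \ {g} := by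
    have := H.union_eq
    rw [delete_ground]
    rw [disjoint_left] at hXB
    have : ∀ x ∈ N.E, x ∈ A ∨ x ∈ B := by grind
    grind [H.left_subset]
  rw [hXZ] at hlow
  replace hlow := (H.conn_le_of_delete hg).trans hlow
  have m1 := rk_submod M X Z
  have m2 := rk_submod M ((M.E \ {e}) \ X) ((M.E \ {g}) \ Z)
  have hgX := hAX hg
  simp only [conn, rk_delete, delete_ground] at hX hZ' hlow
  have t1 : X \ {e} = X := by grind
  have t2 : ((M.E \ {e}) \ X) \ {e} = (M.E \ {e}) \ X := by grind
  have t3 : (M.E \ {e}) \ {e} = M.E \ {e} := by grind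
  have t4 : Z \ {g} = Z := by grind
  have t5 : ((M.E \ {g}) \ Z) \ {g} = (M.E \ {g}) \ Z := by grind
  have t6 : (M.E \ {g}) \ {g} = M.E \ {g} := by grind
  have t7 : ((X ∩ Z) \ {g}) \ {e} = X ∩ Z := by grind
  have t8 : ((((M.E \ {e}) \ {g}) \ (X ∩ Z)) \ {g}) \ {e} =
    ((M.E \ {e}) \ X) ∪ ((M.E \ {g}) \ Z) := by grind
  have t9 : (((M.E \ {e}) \ {g}) \ {g}) \ {e} = (M.E \ {e}) \ {g} := by grind
  have t10 : ((M.E \ {e}) \ X) ∩ ((M.E \ {g}) \ Z) = M.E \ (X ∪ Z) := by grind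
  rw [t1, t2, t3] at hX
  rw [t4, t5, t6] at hZ'
  rw [t7, t8, t9] at hlow
  rw [t10] at m2
  refine ⟨X ∪ Z, hAX.trans subset_union_left, by grind, by simp [hXB, hZB], ?_⟩
  rw [conn]
  omega

/-- If some one-element extension of `N` by `e` inside `M` has `e` as a loop or parallel to an element
of `A`, then `M` is good. -/
lemma SmallerGood.good_of_dep (h : SmallerGood 𝓜 c N A B M) (H : Hyp 𝓜 c N A B) (hM : M ∈ 𝓜)
    (hP : P ≤m M) (hPN : P ＼ {e} = N) (hg : g ∈ A) (hdep : P.Dep {e, g}) :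
    Good A B c M := by
  obtain ⟨K, hKeg, hK⟩ := hdep.exists_isCircuit_subset
  have heK : e ∈ K := by
    by_contra heK
    have hKN : N.IsCircuit K := by rw [← hPN, delete_isCircuit_iff]; simp [hK, heK]
    have h1 := H.simple K hKN
    have h2 : K.encard ≤ 1 := by
      rw [← encard_singleton g]
      exact encard_le_encard (by grind)
    exact absurd (h1.trans h2) (by norm_num)
  by_cases hgK : g ∈ K
  · have hge : e ≠ g := by
      rintro rfl
      have := H.left_subset hg
      simp [← hPN] at this
    refine h.good_of_parallel H hM hP hPN hg ?_ ?_
    · exact P.closure_subset_closure (by grind) (hK.mem_closure_sdiff_singleton_of_mem heK)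
    · exact P.closure_subset_closure (by grind) (hK.mem_closure_sdiff_singleton_of_mem hgK)
  have hKe : K = {e} := by grind
  rw [hKe, singleton_isCircuit] at hK
  exact h.good_of_isLoop H hM hP hK (.inl (by rw [hPN]; exact .refl))

end Hyp

/-! ### Locating the obstructing pair, and the induction. -/

section Main

variable {α : Type*} {𝓜 : Set (Matroid α)} {c : ℤ} {M N P : Matroid α} {A B C D S T X Y K : Set α}
  {e f g x : α}

lemma rk_le_rk_sdiff_add_ncard (M : Matroid α) [M.Finite] (hT : T ⊆ M.E) (S : Set α) :
    rk M S ≤ rk M (S \ T) + T.ncard := by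
  have h1 := rk_mono M (show S ⊆ (S \ T) ∪ T by simp)
  have h2 := rk_union_le M (S \ T) T
  have h3 := rk_le_ncard M hT
  omega

/-- If `T` is skew to `S \ T` and independent, then the closures of the sets `S \ {f}` with `f ∈ T`
meet in the closure of `S \ T`. -/
lemma mem_closure_sdiff_of_forall [M.Finite] (hT : T ⊆ M.E)
    (hr : rk M (S \ T) + T.ncard ≤ rk M S) (he : e ∈ M.closure S)
    (h : ∀ f ∈ T, e ∈ M.closure (S \ {f})) : e ∈ M.closure (S \ T) := by
  have hTfin := M.set_finite T hT
  have hrk : ∀ Q ⊆ T, rk M (S \ Q) + Q.ncard ≤ rk M S := by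
    intro Q hQ
    have h1 := rk_le_rk_sdiff_add_ncard M (sdiff_subset.trans hT : T \ Q ⊆ M.E) (S \ Q)
    have h2 := ncard_sdiff_add_ncard_of_subset hQ hTfin
    rw [sdiff_sdiff, show Q ∪ T \ Q = T by grind] at h1
    omega
  suffices ∀ Q ⊆ T, e ∈ M.closure (S \ Q) from this T subset_rfl
  intro Q hQ
  induction Q, hTfin.subset hQ using Set.Finite.induction_on with
  | empty => simpa
  | @insert f Q hfQ hQfin ih =>
    have hfT : f ∈ T := hQ (by simp)
    have hQT : Q ⊆ T := (subset_insert _ _).trans hQ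
    have h1 := rk_insert_of_mem_closure (ih hQT)
    have h2 := rk_insert_of_mem_closure (h f hfT)
    have h3 := rk_submod M (insert e (S \ Q)) (insert e (S \ {f}))
    have h4 := hrk Q hQT
    have h5 := hrk {f} (by simpa)
    have h6 := rk_le_rk_sdiff_add_ncard M (hQ.trans hT) S
    have h7 := rk_mono M (show S ⊆ insert e (S \ Q) ∪ insert e (S \ {f}) by grind)
    rw [ncard_insert_of_notMem hfQ hQfin] at h6
    rw [ncard_singleton] at h5
    rw [show insert e (S \ Q) ∩ insert e (S \ {f}) = insert e (S \ insert f Q) by grind] at h3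
    refine mem_closure_of_rk_insert (mem_ground_of_mem_closure he) ?_
    omega

/-- Contracting either element makes the other a loop, so both sides equal the contraction of the
pair. -/
lemma contract_delete_eq_of_mem_closure (hef : e ∈ M.closure {f}) (hfe : f ∈ M.closure {e})
    (hne : e ≠ f) : M ／ {e} ＼ {f} = M ／ {f} ＼ {e} := by
  rw [← contract_eq_delete_of_subset_loops, ← contract_eq_delete_of_subset_loops, contract_comm]
  · rw [singleton_subset_iff, ← isLoop_iff, contract_isLoop_iff_mem_closure]
    exact ⟨hef, by simpa⟩
  · rw [singleton_subset_iff, ← isLoop_iff, contract_isLoop_iff_mem_closure]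
    exact ⟨hfe, by simpa using hne.symm⟩

lemma contractElem_dep_of_dep_insert (hf : M.IsNonloop f) (hfX : f ∉ X) (h : M.Dep (insert f X)) :
    (M ／ {f}).Dep X := by
  refine ⟨fun hX ↦ h.not_indep (hf.contractElem_indep_iff.1 hX).2, ?_⟩
  rw [contract_ground, subset_sdiff, disjoint_singleton_right]
  exact ⟨(subset_insert _ _).trans h.subset_ground, hfX⟩

lemma rk_contract_delete [M.Finite] (hC : C ⊆ M.E) (hXD : Disjoint X D) :
    rk (M ／ C ＼ D) X + rk M C = rk M (X ∪ C) := by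
  rw [rk_delete, rk_contract M hC, hXD.sdiff_eq_left]

lemma IsSimple.encard_of_dep (h : IsSimple M) (hX : M.Dep X) : 3 ≤ X.encard := by
  obtain ⟨K, hKX, hK⟩ := hX.exists_isCircuit_subset
  exact (h K hK).trans (encard_le_encard hKX)

lemma exists_eq_pair_of_not_three_le (hx : x ∈ K) (hK : ¬ 3 ≤ K.encard) :
    ∃ y, K = {x, y} ∧ K \ {x} ⊆ {y} := by
  have h1 : (K \ {x}).encard ≤ 1 := by
    by_contra! hlt
    rw [← encard_sdiff_singleton_add_one hx] at hK
    refine hK ?_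
    calc (3 : ℕ∞) = 2 + 1 := by norm_num
      _ ≤ _ := by gcongr; exact Order.add_one_le_of_lt hlt
  obtain h0 | ⟨y, hy⟩ := encard_le_one_iff_eq.1 h1
  · rw [sdiff_eq_empty] at h0
    exact ⟨x, by rw [pair_eq_singleton]; exact h0.antisymm (by simpa), by grind⟩
  · exact ⟨y, by rw [← hy, insert_sdiff_self_of_mem hx], hy.subset⟩

/-- An element `x` of a circuit inside `C` is a loop once `C \ {x}` is contracted. -/
lemma SmallerGood.indep_of_not_good (h : SmallerGood 𝓜 c N A B M) (H : Hyp 𝓜 c N A B) (hM : M ∈ 𝓜)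
    (hbad : ¬ Good A B c M) (hC : C ⊆ M.E) (hN : N = M ／ C ＼ D) : M.Indep C := by
  by_contra hind
  obtain ⟨K, hKC, hK⟩ := ((not_indep_iff hC).1 hind).exists_isCircuit_subset
  obtain ⟨x, hx⟩ := hK.nonempty
  have hxC := hKC hx
  refine hbad (h.good_of_isLoop H hM (contract_isMinor M (C \ {x})) (x := x) ?_ (.inr ?_))
  · rw [contract_isLoop_iff_mem_closure]
    exact ⟨M.closure_subset_closure (sdiff_subset_sdiff_left hKC)
      (hK.mem_closure_sdiff_singleton_of_mem hx), by simp⟩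
  · rw [contract_contract, sdiff_union_of_subset (by simpa), hN]
    exact delete_isMinor _ _

/-- If contracting `C` brings `e` into the closure of `A` and `X` is a good set of `M ＼ e`, then
either `X` spans `e`, or a single element of `C` outside `X` is responsible. -/
lemma exists_notMem_closure_sdiff_singleton [M.Finite] (hC : C ⊆ M.E) (hCD : Disjoint C D)
    (hD : D ⊆ M.E) (hN : N = M ／ C ＼ D) (hind : M.Indep C) (heD : e ∈ D) (hAB : A ∪ B = N.E)
    (hdisj : Disjoint A B) (hconn : conn N A = c) (he : e ∈ M.closure (A ∪ C)) (hAX : A ⊆ X)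
    (hXE : X ⊆ M.E \ {e}) (hXB : Disjoint X B) (hX : conn (M ＼ {e}) X ≤ c)
    (heX : e ∉ M.closure X) : ∃ f ∈ C, f ∉ X ∧ e ∉ M.closure (A ∪ (C \ {f})) := by
  by_contra! hcon
  have hE : M.E = A ∪ B ∪ C ∪ D := by
    rw [hAB, hN, delete_ground, contract_ground]; grind
  have hdN : Disjoint N.E C ∧ Disjoint N.E D := by
    rw [hN, delete_ground, contract_ground]
    exact ⟨disjoint_sdiff_left.mono_left sdiff_subset, disjoint_sdiff_left⟩
  rw [← hAB, disjoint_union_left, disjoint_union_left] at hdN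
  obtain ⟨⟨hAC, hBC⟩, hAD, hBD⟩ := hdN
  refine heX ?_
  have hsub : (A ∪ C) \ (C \ X) ⊆ X := by grind
  refine M.closure_subset_closure hsub (mem_closure_sdiff_of_forall (sdiff_subset.trans hC)
    ?_ he fun f hf ↦ ?_)
  -- Skewness of `C \ X`: compare the trace of `X` on `M ＼ D`, of connectivity at most `c`, with
  -- `conn N A = c` written in ranks of `M`; restoring `C ∩ X` to the `B` side costs at most its
  -- size.
  · have h1 := conn_le_of_isMinor (M := M ＼ {e}) (P := M ＼ D) (X := X) ⟨∅, D, by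
      rw [contract_empty, delete_delete, union_eq_self_of_subset_left (by simpa)]⟩ hXE
    replace h1 := h1.trans hX
    have hXP : X ∩ (M ＼ D).E = (A ∪ C) \ (C \ X) := by
      rw [delete_ground, hE]
      rw [disjoint_left] at hXB hCD hAD hAC hBD hBC
      grind
    have hEP : (A ∪ C) \ (C \ X) ∪ (B ∪ (C \ X)) = (M ＼ D).E := by
      rw [delete_ground, hE]
      rw [disjoint_left] at hXB hCD hAD hAC hBD hBC
      grind
    have hdP : Disjoint ((A ∪ C) \ (C \ X)) (B ∪ (C \ X)) := by
      rw [disjoint_left] at *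
      grind
    rw [hXP, Decomposer.conn_eq hEP hdP, rk_delete, rk_delete, rk_delete, delete_ground] at h1
    have t1 : ((A ∪ C) \ (C \ X)) \ D = (A ∪ C) \ (C \ X) := by
      rw [disjoint_left] at *
      grind
    have t2 : (B ∪ (C \ X)) \ D = B ∪ (C \ X) := by
      rw [disjoint_left] at *
      grind
    have t3 : (M.E \ D) \ D = M.E \ D := by simp
    rw [t1, t2, t3] at h1
    have e1 := rk_contract_delete hC hAD
    have e2 := rk_contract_delete hC hBD
    have e3 := rk_contract_delete (M := M) hC (D := D) (X := N.E)
      (hAB ▸ disjoint_union_left.2 ⟨hAD, hBD⟩)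
    rw [← hN] at e1 e2 e3
    rw [Decomposer.conn_eq hAB hdisj] at hconn
    have t4 : N.E ∪ C = M.E \ D := by
      rw [hN, delete_ground, contract_ground]
      rw [disjoint_left] at hCD
      grind
    rw [t4] at e3
    have e4 := rk_le_rk_sdiff_add_ncard M (inter_subset_left.trans hC : C ∩ X ⊆ M.E) (B ∪ C)
    have t5 : (B ∪ C) \ (C ∩ X) = B ∪ (C \ X) := by
      rw [disjoint_left] at hBC
      grind
    rw [t5] at e4
    have e5 := ncard_inter_add_ncard_sdiff_eq_ncard C X (M.set_finite C hC)
    have e6 := (indep_iff_rk hC).1 hind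
    omega
  · have := hcon f hf.1 hf.2
    rwa [show (A ∪ C) \ {f} = A ∪ C \ {f} by rw [disjoint_left] at hAC; grind]

/-- If `e` cannot be placed with `B` in the extension of `N` by `e`, then `M` is good. -/
lemma SmallerGood.good_of_conn_ne (h : SmallerGood 𝓜 c N A B M) (H : Hyp 𝓜 c N A B) (hM : M ∈ 𝓜)
    (hC : C ⊆ M.E) (hD : D ⊆ M.E) (hCD : Disjoint C D) (hN : N = M ／ C ＼ D) (heD : e ∈ D)
    (hne : conn (M ／ C ＼ (D \ {e})) A ≠ c) : Good A B c M := by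
  by_contra hbad
  have hfin := H.finite _ hM
  have heM := hD heD
  have heC : e ∉ C := hCD.notMem_of_mem_right heD
  have hNM : N ≤m M := ⟨C, D, hN⟩
  have hfinN := H.finite _ (H.minor _ hM _ hNM)
  have hA := H.left_subset
  have hB := H.right_subset
  have hAB := H.union_eq
  have hdisj := H.disjoint
  have hind := h.indep_of_not_good H hM hbad hC hN
  obtain ⟨P, hPdef⟩ : ∃ P, P = M ／ C ＼ (D \ {e}) := ⟨_, rfl⟩
  rw [← hPdef] at hne
  have hPM : P ≤m M := ⟨_, _, hPdef⟩
  have hfinP := H.finite _ (H.minor _ hM _ hPM)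
  have hPN : P ＼ {e} = N := by
    rw [hPdef, delete_delete, sdiff_union_of_subset (by simpa), hN]
  have heP : e ∈ P.E := by rw [hPdef]; simp [heM, heC]
  have heN : e ∉ N.E := by simp [← hPN]
  have hPE : P.E = insert e N.E := by rw [← hPN]; simp [heP]
  have heA : e ∉ A := fun h ↦ heN (hA h)
  have heB : e ∉ B := fun h ↦ heN (hB h)
  have hconnN := H.conn_eq
  rw [Decomposer.conn_eq hAB hdisj, ← hPN, rk_delete, rk_delete, rk_delete, delete_ground,
    sdiff_singleton_eq_self heA, sdiff_singleton_eq_self heB, sdiff_sdiff, union_self] at hconnN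
  have hPAB : conn P A = (rk P A : ℤ) + rk P (insert e B) - rk P P.E :=
    Decomposer.conn_eq (by rw [hPE, ← hAB]; grind) (by simp [hdisj, heA])
  have heclE : P.closure B ⊆ P.closure (P.E \ {e}) := P.closure_subset_closure (by grind)
  have hPinsert : insert e (P.E \ {e}) = P.E := by simp [heP]
  have hPsimple : IsSimple P := by
    intro K hK
    by_contra hK3
    by_cases heK : e ∈ K
    · obtain ⟨g, hKeg, hKg⟩ := exists_eq_pair_of_not_three_le heK hK3
      obtain rfl | hge := eq_or_ne g e
      · rw [hKeg, pair_eq_singleton, singleton_isCircuit] at hK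
        exact hbad (h.good_of_isLoop H hM hPM hK (.inl (by rw [hPN]; exact .refl)))
      have hgE : g ∈ A ∪ B := by
        have : g ∈ P.E := hK.subset_ground (by simp [hKeg])
        rw [hPE, mem_insert_iff, or_iff_right hge] at this
        rwa [hAB]
      obtain hgA | hgB := hgE
      · exact hbad (h.good_of_dep H hM hPM hPN hgA (hKeg ▸ hK.dep))
      -- An element parallel to `B` joins `B` for free, giving `conn P A = c`.
      · have hecl := hK.mem_closure_sdiff_singleton_of_mem heK
        replace hecl := P.closure_subset_closure (hKg.trans (singleton_subset_iff.2 hgB)) hecl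
        have r1 := rk_insert_of_mem_closure hecl
        have r2 := rk_insert_of_mem_closure (heclE hecl)
        rw [hPinsert] at r2
        omega
    · exact hK3 (H.simple K (by rw [← hPN, delete_isCircuit_iff]; simp [hK, heK]))
  have hPAe : conn P (A ∪ {e}) = c :=
    (H.extension P (H.minor _ hM _ hPM) e heP hPN hPsimple).resolve_left hne
  -- Otherwise `e` adds 1 to the rank of `A`. If `B` spans `e`, then `A ∪ {e}` has connectivity `c +
  -- 1`; if not, `A` and `A ∪ {e}` have equal connectivity, against `hne`.
  have heclA : e ∈ P.closure A := by
    by_contra hecl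
    have r1 := rk_insert_of_notMem_closure heP hecl
    rw [Decomposer.conn_eq (Y := B) (by rw [hPE, ← hAB]; grind) (by simp [hdisj, heB]),
      union_singleton] at hPAe
    have r2 := rk_mono P (subset_insert e B)
    by_cases hecB : e ∈ P.closure B
    · have r3 := rk_insert_of_mem_closure (heclE hecB)
      rw [hPinsert] at r3
      omega
    · have r4 := rk_insert_of_notMem_closure heP hecB
      omega
  have hNe : N ≤m M ＼ {e} := hPN ▸ delete_isMinor_delete hPM heP
  obtain ⟨X, hAX, hXE, hXB, hX⟩ := h.delete H hM heM hNe
  have heX : e ∉ M.closure X := by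
    intro hecl
    refine hbad ⟨insert e X, hAX.trans (subset_insert _ _), by grind [delete_ground],
      by simp [hXB, heB], ?_⟩
    rw [delete_ground] at hXE
    have r1 := rk_insert_of_mem_closure hecl
    have r2 := rk_insert_of_mem_closure (M.closure_subset_closure hXE hecl)
    rw [insert_sdiff_self_of_mem heM] at r2
    rw [conn, rk_delete, rk_delete, rk_delete, delete_ground] at hX
    have t1 : X \ {e} = X := by grind
    have t2 : ((M.E \ {e}) \ X) \ {e} = M.E \ insert e X := by grind
    have t3 : (M.E \ {e}) \ {e} = M.E \ {e} := by simp
    rw [t1, t2, t3] at hX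
    rw [conn]
    omega
  obtain ⟨f, hfC, hfX, hf⟩ := exists_notMem_closure_sdiff_singleton hC hCD hD hN hind heD hAB hdisj
    H.conn_eq (mem_closure_of_mem_closure_minor (hPdef ▸ heclA)) hAX hXE hXB hX heX
  -- `Q` restores only `e` and `f`. As `f ∉ X`, the trace of `X` on `Q ＼ {e}` is exactly `A`.
  obtain ⟨Q, hQdef⟩ : ∃ Q, Q = M ／ (C \ {f}) ＼ (D \ {e}) := ⟨_, rfl⟩
  have hfM := hC hfC
  have hfD : f ∉ D := hCD.notMem_of_mem_left hfC
  have hef : e ≠ f := by rintro rfl; exact hfD heD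
  have hQM : Q ≤m M := ⟨_, _, hQdef⟩
  have hQ := H.minor _ hM _ hQM
  have hfinQ := H.finite _ hQ
  have heQ : e ∈ Q.E := by rw [hQdef]; simp [heM, heC]
  have hfQ : f ∈ Q.E := by rw [hQdef]; simp [hfM, hfD]
  have hQf : Q ／ {f} = P := by
    rw [hQdef, ← contract_delete_comm _ (by simp [hfD]), contract_contract,
      sdiff_union_of_subset (by simpa), hPdef]
  have hQN : Q ／ {f} ＼ {e} = N := by rw [hQf, hPN]
  have hQN' : Q ＼ {e} ／ {f} = N := by
    rw [← contract_delete_comm _ (by simpa using hef.symm), hQN]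
  have hNPf : N ≤m Q ／ {f} := hQN ▸ delete_isMinor _ _
  have hfN : f ∉ N.E := by simp [← hQN]
  have hQE : Q.E = insert e (insert f N.E) := by
    rw [← hQN, delete_ground, contract_ground]; grind
  have hfA : f ∉ A := fun h ↦ hfN (hA h)
  have hfB : f ∉ B := fun h ↦ hfN (hB h)
  have heQA : e ∉ Q.closure A := fun hcl ↦
    hf (mem_closure_of_mem_closure_minor (hQdef ▸ hcl))
  have heQAf : e ∈ Q.closure (insert f A) := by
    rw [← hQf, contract_closure_eq, union_singleton] at heclA
    exact heclA.1
  have heQE : e ∈ Q.closure (Q.E \ {e}) := Q.closure_subset_closure (by grind) heQAf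
  have hQeA : conn (Q ＼ {e}) A = c := by
    refine le_antisymm ?_ ?_
    · have h1 := conn_le_of_isMinor (delete_isMinor_delete hQM heQ) hXE
      have h2 : X ∩ (Q ＼ {e}).E = A := by
        rw [delete_ground, hQE, ← hAB]
        rw [disjoint_left] at hXB
        grind
      rw [h2] at h1
      exact h1.trans hX
    · have h1 := conn_le_of_isMinor (M := Q ＼ {e}) (P := N) (X := A)
        (hQN' ▸ contract_isMinor _ _) (by rw [delete_ground, hQE]; grind)
      rwa [inter_eq_self_of_subset_left hA, H.conn_eq] at h1
  -- In `Q`, `A` no longer spans `e` but the whole of the rest does, so the value is `c + 1`.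
  have hQAe : conn Q (A ∪ {e}) ≠ c := by
    intro hc
    have r1 := rk_insert_of_notMem_closure heQ heQA
    have r2 := rk_insert_of_mem_closure heQE
    rw [insert_sdiff_self_of_mem heQ] at r2
    rw [conn, rk_delete, rk_delete, rk_delete, delete_ground] at hQeA
    have t1 : A \ {e} = A := by grind
    have t2 : ((Q.E \ {e}) \ A) \ {e} = Q.E \ insert e A := by grind
    have t3 : (Q.E \ {e}) \ {e} = Q.E \ {e} := by simp
    rw [t1, t2, t3] at hQeA
    rw [conn, union_singleton] at hc
    omega
  have hdual : ∀ q ∈ A, ¬ (Q✶ ／ {e}).Dep {f, q} := by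
    intro q hq hdep
    refine hbad (good_dual_iff.1 ((h.dual H).good_of_dep (H.dual hfinN) (M := M✶) (P := Q✶ ／ {e})
      (e := f) ?_ ?_ ?_ hq hdep))
    · simpa using hM
    · exact (contract_isMinor _ _).trans (isMinor_dual hQM)
    · rw [← dual_inj, dual_contract_delete, dual_dual, dual_dual, hQN']
  have heQdual : Q✶.IsNonloop e := by
    rw [← not_isLoop_iff (by simpa), dual_isLoop_iff_isColoop]
    exact fun hco ↦ (hco.notMem_closure_of_notMem (by simp)) heQE
  have hQcosimple : IsSimple Q✶ := by
    intro K hK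
    by_contra hK3
    by_cases hfK : f ∈ K
    · obtain ⟨q, hKfq, hKq⟩ := exists_eq_pair_of_not_three_le hfK hK3
      obtain rfl | hqf := eq_or_ne q f
      · rw [hKfq, pair_eq_singleton, singleton_isCircuit, dual_isLoop_iff_isColoop] at hK
        exact hbad (h.good_of_isColoop H hM hQM hK (.inr hNPf))
      have hfcl := Q✶.closure_subset_closure hKq (hK.mem_closure_sdiff_singleton_of_mem hfK)
      have hqcl := hK.mem_closure_sdiff_singleton_of_mem (e := q) (by simp [hKfq])
      rw [hKfq, pair_comm, pair_sdiff_left hqf] at hqcl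
      -- If `e` and `f` are in series in `Q`, they are interchangeable, so `N` is also a minor of `Q
      -- ＼ {f}`.
      obtain rfl | hqe := eq_or_ne q e
      · refine hbad (h.good_of_both_minor H hM hQM hfQ ?_ hNPf)
        rw [← isMinor_dual_iff, dual_delete, ← hQN', dual_contract, dual_delete,
          contract_delete_eq_of_mem_closure hqcl hfcl hqf]
        exact delete_isMinor _ _
      have hqE : q ∈ A ∪ B := by
        have : q ∈ Q.E := hK.subset_ground (by simp [hKfq])
        rw [hQE, mem_insert_iff, mem_insert_iff, or_iff_right hqe, or_iff_right hqf] at this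
        rwa [hAB]
      obtain hqA | hqB := hqE
      · refine hdual q hqA (hKfq ▸ hK.contract_dep ?_)
        rw [disjoint_singleton_left, hKfq]
        simp [hef, hqe.symm]
      -- A series partner of `f` in `B` makes contraction of `f` harmless for `A ∪ {e}`, whose
      -- connectivity in `P` is `c`.
      · apply hQAe
        rw [← conn_contract_eq (C := {f}), hQf, hPAe]
        · rw [hQE]; grind
        · simp [hfA, hef.symm]
        · rw [singleton_subset_iff]
          refine Q✶.closure_subset_closure ?_ hfcl
          rw [singleton_subset_iff, hQE]
          simp [hB hqB, hqe, hqf, hdisj.notMem_of_mem_right hqB]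
    -- Such a `K` survives in the dual of `P`. It is not `{e}`, since `A` spans `e` in `P`; so `K \
    -- {e}` is a dependent set of `N✶` that is too small.
    · have hKP : P✶.IsCircuit K := by
        rw [← hQf, dual_contract, delete_isCircuit_iff]
        simp [hK, hfK]
      by_cases hKe : K ⊆ {e}
      · have : K = {e} := hKP.nonempty.subset_singleton_iff.1 hKe
        rw [this, singleton_isCircuit, dual_isLoop_iff_isColoop] at hKP
        exact hKP.notMem_closure_of_notMem heA heclA
      · have hdep := hKP.contract_dep_of_not_subset hKe
        rw [← dual_delete, hPN] at hdep
        exact hK3 ((H.cosimple.encard_of_dep hdep).trans (encard_le_encard sdiff_subset))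
  obtain ⟨g, hg, hdep | hdep⟩ := H.pair Q hQ e heQ f hfQ hef hQN (hQf ▸ hPsimple) hQcosimple
    (hQf ▸ hne) hQeA hQAe
  · obtain hfl | hfn := Q.isLoop_or_isNonloop f hfQ
    · exact hbad (h.good_of_isLoop H hM hQM hfl (.inr hNPf))
    refine hbad (h.good_of_dep H hM hPM hPN hg (hQf ▸ contractElem_dep_of_dep_insert hfn ?_ ?_))
    · simp only [mem_insert_iff, mem_singleton_iff, not_or]
      exact ⟨hef.symm, by rintro rfl; exact hfA hg⟩
    · rwa [insert_comm]
  · refine hdual g hg (contractElem_dep_of_dep_insert heQdual ?_ hdep)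
    simp only [mem_insert_iff, mem_singleton_iff, not_or]
    exact ⟨hef, by rintro rfl; exact heA hg⟩

/-- Each `e ∈ D` keeps `conn P A = c`. As `e` is not a coloop of `P`, the rank does not grow from
`N` to `P`, so neither does that of `B` when `e` joins it. -/
lemma SmallerGood.subset_closure_of_not_good (h : SmallerGood 𝓜 c N A B M) (H : Hyp 𝓜 c N A B)
    (hM : M ∈ 𝓜) (hbad : ¬ Good A B c M) (hC : C ⊆ M.E) (hD : D ⊆ M.E) (hCD : Disjoint C D)
    (hN : N = M ／ C ＼ D) : D ⊆ M.closure (B ∪ C) := by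
  intro e heD
  obtain ⟨P, hPdef⟩ : ∃ P, P = M ／ C ＼ (D \ {e}) := ⟨_, rfl⟩
  have hPM : P ≤m M := ⟨_, _, hPdef⟩
  have hfinP := H.finite _ (H.minor _ hM _ hPM)
  have hPN : P ＼ {e} = N := by
    rw [hPdef, delete_delete, sdiff_union_of_subset (by simpa), hN]
  have heP : e ∈ P.E := by
    rw [hPdef]; simp [hD heD, hCD.notMem_of_mem_right heD]
  have heN : e ∉ N.E := by simp [← hPN]
  have hPE : P.E = insert e N.E := by rw [← hPN]; simp [heP]
  have heA : e ∉ A := fun h ↦ heN (H.left_subset h)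
  have heB : e ∉ B := fun h ↦ heN (H.right_subset h)
  have hconnN := H.conn_eq
  rw [Decomposer.conn_eq H.union_eq H.disjoint, ← hPN, rk_delete, rk_delete, rk_delete,
    delete_ground, sdiff_singleton_eq_self heA, sdiff_singleton_eq_self heB, sdiff_sdiff,
    union_self] at hconnN
  have hPA : conn P A = c := by
    by_contra hne
    exact hbad (h.good_of_conn_ne H hM hC hD hCD hN heD (hPdef ▸ hne))
  rw [Decomposer.conn_eq (Y := insert e B) (by rw [hPE, ← H.union_eq]; grind)
    (by simp [H.disjoint, heA])] at hPA
  refine mem_closure_of_mem_closure_minor (D := D \ {e}) ?_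
  rw [← hPdef]
  by_contra hecl
  have r1 := rk_insert_of_notMem_closure heP hecl
  by_cases hco : e ∈ P.closure (P.E \ {e})
  · have r2 := rk_insert_of_mem_closure hco
    rw [insert_sdiff_self_of_mem heP] at r2
    omega
  · exact hbad (h.good_of_isColoop H hM hPM ((isColoop_iff_notMem_closure_compl heP).2 hco)
      (.inl (by rw [hPN]; exact .refl)))

theorem Hyp.good (H : Hyp 𝓜 c N A B) (hM : M ∈ 𝓜) (hNM : N ≤m M) : Good A B c M := by
  induction hn : M.E.ncard using Nat.strong_induction_on generalizing M with
  | _ n ih =>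
  subst hn
  have h : SmallerGood 𝓜 c N A B M := fun P hP hNP hlt ↦ ih _ hlt hP hNP rfl
  have hfin := H.finite _ hM
  have hfinN := H.finite _ (H.minor _ hM _ hNM)
  obtain ⟨C, D, hC, hD, hCD, hN⟩ := hNM.exists_eq_contract_delete_disjoint
  by_contra hbad
  have hDcl := h.subset_closure_of_not_good H hM hbad hC hD hCD hN
  have hCcl := (h.dual H).subset_closure_of_not_good (H.dual hfinN) (by simpa using hM)
    (good_dual_iff.not.2 hbad) hD hC hCD.symm
    (by rw [hN, dual_contract_delete, contract_delete_comm _ hCD.symm])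
  have hAB := H.union_eq
  have hNE : N.E = (M.E \ C) \ D := by rw [hN]; simp
  have hdisj := H.disjoint
  rw [disjoint_left] at hdisj hCD
  have hA : A ⊆ (M.E \ C) \ D := hNE ▸ H.left_subset
  have hB : B ⊆ (M.E \ C) \ D := hNE ▸ H.right_subset
  have hAM : A ⊆ M.E := hA.trans (sdiff_subset.trans sdiff_subset)
  refine hbad ⟨A, subset_rfl, hAM, H.disjoint, ?_⟩
  rw [← conn_delete_eq (D := D), ← conn_contract_eq (C := C), ← contract_delete_comm, ← hN,
    H.conn_eq]
  · rwa [disjoint_left]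
  · rw [delete_ground]; grind
  · rw [disjoint_left]; grind
  · rw [dual_delete, contract_closure_eq, delete_ground]
    refine subset_sdiff.2 ⟨hCcl.trans (M✶.closure_subset_closure ?_), by rwa [disjoint_left]⟩
    grind
  · rw [disjoint_left]; grind
  · refine hDcl.trans (M.closure_subset_closure ?_)
    grind

lemma IsUnionOfCircuits.mem_closure (h : IsUnionOfCircuits M A) (hg : g ∈ A) :
    g ∈ M.closure (A \ {g}) := by
  obtain ⟨S, hS, rfl⟩ := h
  obtain ⟨K, hKS, hgK⟩ := hg
  exact M.closure_subset_closure (sdiff_subset_sdiff_left (subset_sUnion_of_mem hKS))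
    ((hS K hKS).mem_closure_sdiff_singleton_of_mem hgK)

lemma HasTriangleOrTriad.exists_dep (h : HasTriangleOrTriad M A e f) :
    ∃ g ∈ A, M.Dep {e, f, g} ∨ M✶.Dep {e, f, g} := by
  obtain ⟨g, hg, h | h⟩ := h
  · exact ⟨g, hg, .inl h.1.dep⟩
  · exact ⟨g, hg, .inr h.1.isCircuit.dep⟩

end Main

end Decomposer

theorem theorem1p1 {α : Type*} (𝓜 : Set (Matroid α)) (h𝓜 : Decomposer.IsMinorClosedClass 𝓜)
    (k : ℕ) (hk : 1 ≤ k) (N : Matroid α) (hN : N ∈ 𝓜)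
    (hsimple : Decomposer.IsSimple N) (hcosimple : Decomposer.IsCosimple N)
    (A B : Set α) (hAB : Decomposer.IsExactSeparation N k A B)
    (hAcirc : Decomposer.IsUnionOfCircuits N A) (hAcocirc : Decomposer.IsUnionOfCocircuits N A)
    (h_i : ∀ M ∈ 𝓜, ∀ e : α, Decomposer.IsSimpleExtension M N e →
      Decomposer.conn M A = (k : ℤ) - 1 ∨ Decomposer.conn M (A ∪ {e}) = (k : ℤ) - 1)
    (h_ii : ∀ M ∈ 𝓜, ∀ f : α, Decomposer.IsCosimpleCoextension M N f →
      Decomposer.conn M A = (k : ℤ) - 1 ∨ Decomposer.conn M (A ∪ {f}) = (k : ℤ) - 1)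
    (h_iii : ∀ M ∈ 𝓜, ∀ e f : α,
      ((∃ L, Decomposer.IsSimpleExtension L N e ∧ Decomposer.IsCosimpleCoextension M L f) ∨
        (∃ L, Decomposer.IsCosimpleCoextension L N f ∧ Decomposer.IsSimpleExtension M L e)) →
      -- (a)
      (Decomposer.conn (M.contract {f}) A = (k : ℤ) - 1 ∧
        Decomposer.conn (M.delete {e}) A = (k : ℤ) - 1) ∨
      -- (b)
      ((Decomposer.conn (M.contract {f}) A = (k : ℤ) - 1 ∧
          Decomposer.conn (M.delete {e}) (A ∪ {f}) = (k : ℤ) - 1) ∧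
        (Decomposer.conn M (A ∪ {f}) = (k : ℤ) - 1 ∨
          Decomposer.HasTriangleOrTriad M A e f)) ∨
      -- (c)
      ((Decomposer.conn (M.contract {f}) (A ∪ {e}) = (k : ℤ) - 1 ∧
          Decomposer.conn (M.delete {e}) A = (k : ℤ) - 1) ∧
        (Decomposer.conn M (A ∪ {e}) = (k : ℤ) - 1 ∨
          Decomposer.HasTriangleOrTriad M A e f)) ∨
      -- (d)
      ((Decomposer.conn (M.contract {f}) (A ∪ {e}) = (k : ℤ) - 1 ∧
          Decomposer.conn (M.delete {e}) (A ∪ {f}) = (k : ℤ) - 1) ∧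
        Decomposer.HasTriangleOrTriad M A e f)) :
    ∀ M ∈ 𝓜, N.IsMinor M → Decomposer.IsDecomposer k N M A B := by
  intro M hM hNM
  have H : Decomposer.Hyp 𝓜 ((k : ℤ) - 1) N A B :=
    { finite := h𝓜.finite
      minor := h𝓜.minor
      iso := fun M hM σ ↦ h𝓜.iso M hM σ σ.injective.injOn
      simple := hsimple
      cosimple := hcosimple
      union_eq := hAB.union_eq
      disjoint := hAB.disjoint
      conn_eq := hAB.conn_eq
      mem_closure := fun g hg ↦ hAcirc.mem_closure hg
      mem_dual_closure := fun g hg ↦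
        Decomposer.IsUnionOfCircuits.mem_closure (M := N.dual) hAcocirc hg
      extension := fun M hM e he hMN hs ↦ h_i M hM e ⟨hs, he, hMN⟩
      coextension := fun M hM f hf hMN hs ↦ h_ii M hM f ⟨hs, hf, hMN⟩
      pair := fun M hM e he f hf hne hMN hs hs' h1 h2 h3 ↦ by
        -- Here `h1` rules out (a) and (b), and `h3` forces the triangle or triad in (c).
        have h := h_iii M hM e f (.inl ⟨M.contract {f}, ⟨hs, ⟨he, hne⟩, hMN⟩, ⟨hs', hf, rfl⟩⟩)
        rcases h with h | h | h | h
        · exact absurd h.1 h1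
        · exact absurd h.1.1 h1
        · exact (h.2.resolve_left h3).exists_dep
        · exact h.2.exists_dep
      copair := fun M hM e he f hf hne hMN hs hs' h1 h2 h3 ↦ by
        have hMN' : (M.delete {e}).contract {f} = N := by
          rw [← Matroid.contract_delete_comm _ (by simpa using hne.symm), hMN]
        have h := h_iii M hM e f
          (.inr ⟨M.delete {e}, ⟨hs, ⟨hf, hne.symm⟩, hMN'⟩, ⟨hs', he, rfl⟩⟩)
        rcases h with h | h | h | h
        · exact absurd h.2 h1
        · exact (h.2.resolve_left h3).exists_dep
        · exact absurd h.1.2 h1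
        · exact h.2.exists_dep }
  have hfin := h𝓜.finite M hM
  obtain ⟨X, hAX, hXE, hXB, hX⟩ := H.good hM hNM
  refine ⟨hNM, hAB, X, M.E \ X, ?_, hAX, ?_⟩
  · have hBX : B ⊆ M.E \ X := Set.subset_sdiff.2 ⟨H.right_subset.trans hNM.subset, hXB.symm⟩
    refine ⟨Set.union_sdiff_cancel hXE, Set.disjoint_sdiff_right,
      hAB.le_left.trans (Set.encard_le_encard hAX), hAB.le_right.trans (Set.encard_le_encard hBX),
      le_antisymm hX ?_⟩
    -- Exactness: `X` meets the ground set of `N` in `A`, so its connectivity is at least `k - 1`.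
    have h1 := Decomposer.conn_le_of_isMinor hNM hXE
    have h2 : X ∩ N.E = A := by
      rw [← hAB.union_eq, Set.inter_union_distrib_left, hXB.inter_eq, Set.union_empty,
        Set.inter_eq_self_of_subset_right hAX]
    rwa [h2, hAB.conn_eq] at h1
  · exact Set.subset_sdiff.2 ⟨H.right_subset.trans hNM.subset, hXB.symm⟩
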